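/- Write $\lg=\log_2$. For a probability vector $p=(p_1,\dots,p_n)$ with all $p_i>0$, let $\mathcal L_n$ be the set of vectors $l$ of nonnegative integers with $\sum_{i=1}^n 2^{-l_i}\le 1$, and for $l\in\mathcal L_n$ and real $d\ne 0$ put $$\bar R(l,p)=\sum_i p_i(l_i+\lg p_i),\qquad R^*(l,p)=\max_i\,(l_i+\lg p_i),\qquad R^d(l,p)=\frac1d\lg\sum_i p_i^{1+d}2^{d l_i}.$$ Let $\bar R_{\rm opt}(p)$, $R^*_{\rm opt}(p)$, $R^d_{\rm opt}(p)$ denote the minima of these quantities over $l\in\mathcal L_n$ (the minima are attained). Then, for every $p$: (i) If $d>0$, then $0\le\bar R_{\rm opt}(p)\le R^d_{\rm opt}(p)\le R^*_{\rm opt}(p)<1$. If $d<0$, then $R^d_{\rm opt}(p)\le\bar R_{\rm opt}(p)\le R^*_{\rm opt}(p)<1$, and if moreover $d>-1$, then $0\le R^d_{\rm opt}(p)$. (ii) For every real $d\neq 0$ and every $j$: if $p_j\ge 2/3$, then $R^d_{\rm opt}(p)\le 1+\lg p_j$; if $1/2\le p_j<2/3$, then $R^d_{\rm opt}(p)<2+\lg(1-p_j)$;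 and if $p_j<1/2$ and $\lambda_j=\lceil-\lg p_j\rceil$, then $$R^d_{\rm opt}(p)<1+\lg\frac{1-p_j}{1-2^{-\lambda_j}}\ \text{ when } p_j<\frac{2}{2^{\lambda_j}+1},\qquad R^d_{\rm opt}(p)\le\lambda_j+\lg p_j\ \text{ when } p_j\ge\frac{2}{2^{\lambda_j}+1}.$$ (iii) If $d<0$, every upper bound for minimum average redundancy (Huffman coding) that is a function of one probability is an upper bound for $R^d_{\rm opt}$: if $\omega:\mathbb R\to\mathbb R$ satisfies $\bar R_{\rm opt}(q)\le\omega(q_i)$ for all $q$ and $i$, then $R^d_{\rm opt}(p)\le\omega(p_j)$ for all $j$. The same holds if, in both the hypothesis and the conclusion, only indices of a largest probability are considered. (iv) For every $j$ with $p_j\in(0,1)$, $$\bar R_{\rm opt}(p)\ \ge\ \xi-(1-p_j)\lg(2^{\xi}-1)-H(p_j),\qquad \xi=\left\lceil\lg\frac{1-2^{1/(p_j-1)}}{1-2^{p_j/(p_j-1)}}\right\rceil,\quad H(x)=-x\lg x-(1-x)\lg(1-x),$$ and for every $d>0$ the same expression is a lower bound for $R^d_{\rm opt}(p)$. The bound for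 $\bar R_{\rm opt}$ is tight, whether or not $p_j$ is known to be the largest probability: for every $x\in(0,1)$ there is a $p$ whose largest probability is $p_j=x$ for which it holds with equality. -/

import Mathlib

/-- The binary logarithm. -/
noncomputable def lg (x : ℝ) : ℝ := Real.logb 2 x

/-- A probability mass function on an `n`-letter alphabet, all letters having positive probability
(in any order). -/
structure IsProbVec {n : ℕ} (p : Fin n → ℝ) : Prop where
  pos : ∀ i, 0 < p i
  sum_eq_one : ∑ i, p i = 1

/-- The allowable codeword length vectors: natural numbers satisfying the Kraft inequality.
For `n ≥ 2` the inequality forces every length to be positive; for `n = 1` the empty codeword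
is allowed. -/
def kraftLengths (n : ℕ) : Set (Fin n → ℕ) :=
  {l | ∑ i, ((2 : ℝ) ^ l i)⁻¹ ≤ 1}

/-- Average redundancy. -/
noncomputable def avgRedundancy {n : ℕ} (p : Fin n → ℝ) (l : Fin n → ℕ) : ℝ :=
  ∑ i, p i * ((l i : ℝ) + lg (p i))

/-- Maximum pointwise redundancy. -/
noncomputable def maxRedundancy {n : ℕ} (p : Fin n → ℝ) (l : Fin n → ℕ) : ℝ :=
  ⨆ i, ((l i : ℝ) + lg (p i))

/-- `d`-th exponential redundancy, for real `d ≠ 0`. -/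
noncomputable def expRedundancy {n : ℕ} (d : ℝ) (p : Fin n → ℝ) (l : Fin n → ℕ) : ℝ :=
  (1 / d) * lg (∑ i, p i ^ (1 + d) * (2 : ℝ) ^ (d * (l i : ℝ)))

/-- The optimal value of an objective over all allowable length vectors. -/
noncomputable def optimum {n : ℕ} (R : (Fin n → ℕ) → ℝ) : ℝ :=
  sInf (R '' kraftLengths n)

/-- Minimum average redundancy (the value attained by Huffman coding). -/
noncomputable def avgOpt {n : ℕ} (p : Fin n → ℝ) : ℝ := optimum (avgRedundancy p)

/-- Minimum maximum pointwise redundancy. -/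
noncomputable def maxOpt {n : ℕ} (p : Fin n → ℝ) : ℝ := optimum (maxRedundancy p)

/-- Minimum `d`-th exponential redundancy. -/
noncomputable def expOpt {n : ℕ} (d : ℝ) (p : Fin n → ℝ) : ℝ := optimum (expRedundancy d p)

/-- The binary entropy function, in bits. -/
noncomputable def binaryEntropy (x : ℝ) : ℝ := -x * lg x - (1 - x) * lg (1 - x)

/-- The integer `ξ` of the lower bound, as a function of a probability `x ∈ (0, 1)`. -/
noncomputable def xi (x : ℝ) : ℤ :=
  ⌈lg ((1 - (2 : ℝ) ^ (1 / (x - 1))) / (1 - (2 : ℝ) ^ (x / (x - 1))))⌉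

/-- The lower bound for average redundancy, as a function of a probability `x ∈ (0, 1)`. -/
noncomputable def huffmanLowerBound (x : ℝ) : ℝ :=
  (xi x : ℝ) - (1 - x) * lg ((2 : ℝ) ^ xi x - 1) - binaryEntropy x

/-!
All three redundancies are monotone in the lengths, and `Fin n → ℕ` is well-quasi-ordered, so their
infima over the allowable lengths are attained. The comparisons then hold length vector by length
vector: the exponential redundancy is a logarithmic average of the pointwise redundancies, so that
Jensen's inequality puts it above (`d > 0`) or below (`d < 0`) the average redundancy, and the
maximum dominates both. The log-sum inequality gives nonnegativity for the average, and weighted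
AM-GM gives it for `-1 < d < 0`.

Since the maximum also dominates for every `d`, the upper bounds in terms of `p j` need only be
proved for `maxOpt`. There the letter `j` gets a prescribed length `k`, and the probabilities of the
other letters, scaled to fill the rest of the Kraft sum, are rounded down to powers of `1 / 2`
(`IsProbVec.exists_kraftLengths_of_scale`). The two bounds correspond to two scalings: one that
fills the Kraft sum, and one that keeps the other pointwise redundancies below that of `j`.

For the lower bound, the log-sum inequality over the letters other than `j` bounds the average
redundancy by a function of `l j` alone (`IsProbVec.le_avgRedundancy`). Up to the entropy term this
is `lengthCost (p j)`, whose increments are nonnegative exactly from `xi (p j)` on. Equality holds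
when `l j = xi (p j)`, the code is complete, and the other probabilities are equal with equal
lengths; extending the other codewords makes these probabilities as small as desired.
-/

/-! ### Binary logarithms and convexity -/

theorem lg_mul {x y : ℝ} (hx : 0 < x) (hy : 0 < y) : lg (x * y) = lg x + lg y :=
  Real.logb_mul hx.ne' hy.ne'

theorem lg_div {x y : ℝ} (hx : 0 < x) (hy : 0 < y) : lg (x / y) = lg x - lg y :=
  Real.logb_div hx.ne' hy.ne'

theorem lg_one : lg 1 = 0 := Real.logb_one

theorem lg_rpow (x : ℝ) : lg ((2 : ℝ) ^ x) = x :=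
  Real.logb_rpow (by norm_num) (by norm_num)

theorem rpow_lg {x : ℝ} (hx : 0 < x) : (2 : ℝ) ^ lg x = x :=
  Real.rpow_logb (by norm_num) (by norm_num) hx

theorem lg_pow (k : ℕ) : lg ((2 : ℝ) ^ k) = k := by
  rw [← Real.rpow_natCast, lg_rpow]

theorem lg_two : lg 2 = 1 := by
  simpa using lg_pow 1

theorem lg_le_lg {x y : ℝ} (hx : 0 < x) (h : x ≤ y) : lg x ≤ lg y :=
  (Real.logb_le_logb (by norm_num) hx (hx.trans_le h)).2 h

theorem lg_lt_lg {x y : ℝ} (hx : 0 < x) (h : x < y) : lg x < lg y :=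
  (Real.logb_lt_logb_iff (by norm_num) hx (hx.trans h)).2 h

theorem natCast_add_lg (k : ℕ) {x : ℝ} (hx : 0 < x) : (k : ℝ) + lg x = lg (2 ^ k * x) := by
  rw [lg_mul (by positivity) hx, lg_pow]

/-- Jensen's inequality for the binary logarithm. -/
theorem sum_mul_lg_le {ι : Type*} (s : Finset ι) (w z : ι → ℝ) (hw : ∀ i ∈ s, 0 ≤ w i)
    (hw1 : ∑ i ∈ s, w i = 1) (hz : ∀ i ∈ s, 0 < z i) :
    ∑ i ∈ s, w i * lg (z i) ≤ lg (∑ i ∈ s, w i * z i) := by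
  have h := strictConcaveOn_log_Ioi.concaveOn.le_map_sum hw hw1 hz
  simp only [smul_eq_mul] at h
  have h2 : (0 : ℝ) < Real.log 2 := Real.log_pos (by norm_num)
  simp only [lg, Real.logb, ← mul_div_assoc, ← Finset.sum_div]
  gcongr

/-- The log-sum inequality. -/
theorem sum_mul_lg_div_le {ι : Type*} (s : Finset ι) (a b : ι → ℝ) (ha : ∀ i ∈ s, 0 < a i)
    (hb : ∀ i ∈ s, 0 < b i) (hs : s.Nonempty) :
    ∑ i ∈ s, a i * lg (b i / a i) ≤
      (∑ i ∈ s, a i) * lg ((∑ i ∈ s, b i) / ∑ i ∈ s, a i) := by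
  have hA : 0 < ∑ i ∈ s, a i := Finset.sum_pos ha hs
  have h := sum_mul_lg_le s (fun i => a i / ∑ i ∈ s, a i) (fun i => b i / a i)
    (fun i hi => (div_pos (ha i hi) hA).le)
    (by rw [← Finset.sum_div, div_self hA.ne'])
    (fun i hi => div_pos (hb i hi) (ha i hi))
  have e : ∑ i ∈ s, a i / (∑ i ∈ s, a i) * (b i / a i) = (∑ i ∈ s, b i) / ∑ i ∈ s, a i := by
    rw [Finset.sum_div]
    refine Finset.sum_congr rfl fun i hi => ?_
    have := (ha i hi).ne'
    field_simp
  rw [e] at h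
  have h' := mul_le_mul_of_nonneg_left h hA.le
  rw [Finset.mul_sum] at h'
  refine le_trans (le_of_eq ?_) h'
  refine Finset.sum_congr rfl fun i _ => ?_
  field_simp

/-! ### Monotonicity of the redundancies -/

namespace IsProbVec

variable {n : ℕ} {p : Fin n → ℝ}

theorem nonempty (hp : IsProbVec p) : Nonempty (Fin n) := by
  by_contra h
  rw [not_nonempty_iff] at h
  simpa using hp.sum_eq_one

theorem sum_erase (hp : IsProbVec p) (j : Fin n) : ∑ i ∈ Finset.univ.erase j, p i = 1 - p j := by
  rw [← hp.sum_eq_one, ← Finset.add_sum_erase _ _ (Finset.mem_univ j)]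
  ring

theorem avgRedundancy_mono (hp : IsProbVec p) : Monotone (avgRedundancy p) := by
  intro l m h
  refine Finset.sum_le_sum fun i _ => mul_le_mul_of_nonneg_left ?_ (hp.pos i).le
  have : (l i : ℝ) ≤ m i := by exact_mod_cast h i
  linarith

end IsProbVec

theorem le_maxRedundancy {n : ℕ} (p : Fin n → ℝ) (l : Fin n → ℕ) (i : Fin n) :
    (l i : ℝ) + lg (p i) ≤ maxRedundancy p l :=
  le_ciSup (f := fun i => (l i : ℝ) + lg (p i)) (Set.finite_range _).bddAbove i

theorem maxRedundancy_lt {n : ℕ} {p : Fin n → ℝ} {l : Fin n → ℕ} {B : ℝ} [Nonempty (Fin n)]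
    (h : ∀ i, (l i : ℝ) + lg (p i) < B) : maxRedundancy p l < B := by
  obtain ⟨i, hi⟩ := exists_eq_ciSup_of_finite (f := fun i => (l i : ℝ) + lg (p i))
  rw [maxRedundancy, ← hi]
  exact h i

namespace IsProbVec

variable {n : ℕ} {p : Fin n → ℝ}

theorem maxRedundancy_mono (hp : IsProbVec p) : Monotone (maxRedundancy p) := by
  intro l m h
  have := hp.nonempty
  refine ciSup_le fun i => le_trans ?_ (le_maxRedundancy p m i)
  have : (l i : ℝ) ≤ m i := by exact_mod_cast h i
  linarith

/-- The argument of the logarithm in the exponential redundancy, as an average of powers of the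
pointwise redundancies. -/
theorem expSum_eq (hp : IsProbVec p) (d : ℝ) (l : Fin n → ℕ) :
    ∑ i, p i ^ (1 + d) * (2 : ℝ) ^ (d * (l i : ℝ)) =
      ∑ i, p i * (2 : ℝ) ^ (d * ((l i : ℝ) + lg (p i))) := by
  refine Finset.sum_congr rfl fun i _ => ?_
  have h : (2 : ℝ) ^ (d * lg (p i)) = p i ^ d := by
    rw [mul_comm, Real.rpow_mul two_pos.le, rpow_lg (hp.pos i)]
  rw [mul_add, Real.rpow_add two_pos, h, Real.rpow_add (hp.pos i), Real.rpow_one]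
  ring

theorem expSum_pos (hp : IsProbVec p) (d : ℝ) (l : Fin n → ℕ) :
    0 < ∑ i, p i ^ (1 + d) * (2 : ℝ) ^ (d * (l i : ℝ)) := by
  have := hp.nonempty
  refine Finset.sum_pos (fun i _ => ?_) Finset.univ_nonempty
  have := hp.pos i
  positivity

theorem expRedundancy_mono (hp : IsProbVec p) (d : ℝ) : Monotone (expRedundancy d p) := by
  intro l m h
  have hlm : ∀ i, (l i : ℝ) ≤ m i := fun i => by exact_mod_cast h i
  unfold expRedundancy
  rcases le_or_gt 0 d with hd | hd
  · refine mul_le_mul_of_nonneg_left (lg_le_lg (hp.expSum_pos d l) ?_) (by positivity)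
    refine Finset.sum_le_sum fun i _ =>
      mul_le_mul_of_nonneg_left ?_ (Real.rpow_nonneg (hp.pos i).le _)
    exact Real.rpow_le_rpow_of_exponent_le (by norm_num) (mul_le_mul_of_nonneg_left (hlm i) hd)
  · refine mul_le_mul_of_nonpos_left (lg_le_lg (hp.expSum_pos d m) ?_)
      (one_div_nonpos.2 hd.le)
    refine Finset.sum_le_sum fun i _ =>
      mul_le_mul_of_nonneg_left ?_ (Real.rpow_nonneg (hp.pos i).le _)
    exact Real.rpow_le_rpow_of_exponent_le (by norm_num)
      (mul_le_mul_of_nonpos_left (hlm i) hd.le)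

end IsProbVec

/-! ### Rounding to dyadic weights and attainment of the minima -/

theorem exists_inv_two_pow_near {q : ℝ} (h0 : 0 < q) (h1 : q ≤ 1) :
    ∃ k : ℕ, ((2 : ℝ) ^ k)⁻¹ ≤ q ∧ q < 2 * ((2 : ℝ) ^ k)⁻¹ := by
  obtain ⟨m, hm, hm'⟩ := exists_nat_pow_near_of_lt_one h0 h1
    (by norm_num : (0 : ℝ) < 2⁻¹) (by norm_num)
  rcases hm'.eq_or_lt with h | h
  · exact ⟨m, by rw [h, inv_pow], by rw [← inv_pow, ← h]; linarith⟩
  · refine ⟨m + 1, by rw [← inv_pow]; exact hm.le, ?_⟩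
    rw [← inv_pow, pow_succ]
    linarith

/-- Rounding sub-probability weights down to powers of `1 / 2` gives an allowable length vector;
for the weights `p` this is the Shannon code. -/
theorem exists_kraftLengths_near {n : ℕ} (q : Fin n → ℝ) (hq : ∀ i, 0 < q i) (hs : ∑ i, q i ≤ 1) :
    ∃ l ∈ kraftLengths n, ∀ i, ((2 : ℝ) ^ l i)⁻¹ ≤ q i ∧ q i < 2 * ((2 : ℝ) ^ l i)⁻¹ := by
  have h1 : ∀ i, q i ≤ 1 := fun i =>
    (Finset.single_le_sum (fun k _ => (hq k).le) (Finset.mem_univ i)).trans hs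
  choose l hl using fun i => exists_inv_two_pow_near (hq i) (h1 i)
  exact ⟨l, (Finset.sum_le_sum fun i _ => (hl i).1).trans hs, hl⟩

/-- A monotone objective attains its infimum over the allowable length vectors, even when it is not
coercive (as for `expRedundancy d` with `d < 0`), because `Fin n → ℕ` is well-quasi-ordered. -/
theorem isLeast_optimum {n : ℕ} {R : (Fin n → ℕ) → ℝ} (hR : Monotone R)
    (hne : (kraftLengths n).Nonempty) : IsLeast (R '' kraftLengths n) (optimum R) := by
  have hwf : (R '' kraftLengths n).IsWF :=
    ((kraftLengths n).isPWO_of_wellQuasiOrderedLE.image_of_monotone hR).isWF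
  have h : IsLeast (R '' kraftLengths n) (hwf.min (hne.image R)) :=
    ⟨hwf.min_mem _, fun _ hb => hwf.min_le _ hb⟩
  rw [optimum, h.csInf_eq]
  exact h

theorem optimum_le_optimum {n : ℕ} {R S : (Fin n → ℕ) → ℝ}
    (hR : IsLeast (R '' kraftLengths n) (optimum R))
    (hS : IsLeast (S '' kraftLengths n) (optimum S))
    (h : ∀ l, R l ≤ S l) : optimum R ≤ optimum S := by
  obtain ⟨l, hl, e⟩ := hS.1
  rw [← e]
  exact (hR.2 ⟨l, hl, rfl⟩).trans (h l)

namespace IsProbVec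

variable {n : ℕ} {p : Fin n → ℝ}

/-- The Shannon code has all pointwise redundancies below one bit. -/
theorem exists_maxRedundancy_lt_one (hp : IsProbVec p) :
    ∃ l ∈ kraftLengths n, maxRedundancy p l < 1 := by
  have := hp.nonempty
  obtain ⟨l, hl, h⟩ := exists_kraftLengths_near p hp.pos hp.sum_eq_one.le
  refine ⟨l, hl, maxRedundancy_lt fun i => ?_⟩
  rw [natCast_add_lg _ (hp.pos i), ← lg_two]
  refine lg_lt_lg (mul_pos (by positivity) (hp.pos i)) ?_
  calc (2 : ℝ) ^ l i * p i < 2 ^ l i * (2 * ((2 : ℝ) ^ l i)⁻¹) := by gcongr; exact (h i).2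
    _ = 2 := by field_simp

theorem kraftLengths_nonempty (hp : IsProbVec p) : (kraftLengths n).Nonempty :=
  let ⟨l, hl, _⟩ := hp.exists_maxRedundancy_lt_one
  ⟨l, hl⟩

theorem isLeast_avgOpt (hp : IsProbVec p) :
    IsLeast (avgRedundancy p '' kraftLengths n) (avgOpt p) :=
  isLeast_optimum hp.avgRedundancy_mono hp.kraftLengths_nonempty

theorem isLeast_maxOpt (hp : IsProbVec p) :
    IsLeast (maxRedundancy p '' kraftLengths n) (maxOpt p) :=
  isLeast_optimum hp.maxRedundancy_mono hp.kraftLengths_nonempty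

theorem isLeast_expOpt (hp : IsProbVec p) (d : ℝ) :
    IsLeast (expRedundancy d p '' kraftLengths n) (expOpt d p) :=
  isLeast_optimum (hp.expRedundancy_mono d) hp.kraftLengths_nonempty

theorem maxOpt_lt_one (hp : IsProbVec p) : maxOpt p < 1 :=
  let ⟨l, hl, h⟩ := hp.exists_maxRedundancy_lt_one
  (hp.isLeast_maxOpt.2 ⟨l, hl, rfl⟩).trans_lt h

/-! ### Comparison of the redundancies -/

/-- Jensen's inequality, before division by `d`; the sign of `d` decides on which side the
exponential redundancy lies. -/
theorem mul_avgRedundancy_le (hp : IsProbVec p) (d : ℝ) (l : Fin n → ℕ) :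
    d * avgRedundancy p l ≤ lg (∑ i, p i ^ (1 + d) * (2 : ℝ) ^ (d * (l i : ℝ))) := by
  have h := sum_mul_lg_le Finset.univ p (fun i => (2 : ℝ) ^ (d * ((l i : ℝ) + lg (p i))))
    (fun i _ => (hp.pos i).le) hp.sum_eq_one (fun i _ => by positivity)
  rw [hp.expSum_eq]
  refine le_trans (le_of_eq ?_) h
  rw [avgRedundancy, Finset.mul_sum]
  refine Finset.sum_congr rfl fun i _ => ?_
  rw [lg_rpow]
  ring

theorem avgRedundancy_le_expRedundancy (hp : IsProbVec p) {d : ℝ} (hd : 0 < d) (l : Fin n → ℕ) :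
    avgRedundancy p l ≤ expRedundancy d p l := by
  rw [expRedundancy, one_div_mul_eq_div, le_div_iff₀ hd, mul_comm]
  exact hp.mul_avgRedundancy_le d l

theorem expRedundancy_le_avgRedundancy (hp : IsProbVec p) {d : ℝ} (hd : d < 0) (l : Fin n → ℕ) :
    expRedundancy d p l ≤ avgRedundancy p l := by
  rw [expRedundancy, one_div_mul_eq_div, div_le_iff_of_neg hd, mul_comm]
  exact hp.mul_avgRedundancy_le d l

theorem expRedundancy_le_maxRedundancy (hp : IsProbVec p) {d : ℝ} (hd : 0 < d) (l : Fin n → ℕ) :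
    expRedundancy d p l ≤ maxRedundancy p l := by
  rw [expRedundancy, one_div_mul_eq_div, div_le_iff₀ hd]
  have h : ∑ i, p i ^ (1 + d) * (2 : ℝ) ^ (d * (l i : ℝ)) ≤ 2 ^ (maxRedundancy p l * d) := by
    rw [hp.expSum_eq, ← one_mul ((2 : ℝ) ^ _), ← hp.sum_eq_one, Finset.sum_mul]
    refine Finset.sum_le_sum fun i _ => mul_le_mul_of_nonneg_left ?_ (hp.pos i).le
    refine Real.rpow_le_rpow_of_exponent_le (by norm_num) ?_
    rw [mul_comm]
    exact mul_le_mul_of_nonneg_right (le_maxRedundancy p l i) hd.le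
  exact (lg_le_lg (hp.expSum_pos d l) h).trans_eq (lg_rpow _)

theorem avgRedundancy_le_maxRedundancy (hp : IsProbVec p) (l : Fin n → ℕ) :
    avgRedundancy p l ≤ maxRedundancy p l := by
  rw [← one_mul (maxRedundancy p l), ← hp.sum_eq_one, Finset.sum_mul]
  exact Finset.sum_le_sum fun i _ =>
    mul_le_mul_of_nonneg_left (le_maxRedundancy p l i) (hp.pos i).le

theorem mul_natCast_add_lg (hp : IsProbVec p) (l : Fin n → ℕ) (i : Fin n) :
    p i * ((l i : ℝ) + lg (p i)) = -(p i * lg (((2 : ℝ) ^ l i)⁻¹ / p i)) := by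
  rw [lg_div (by positivity) (hp.pos i), ← one_div, lg_div one_pos (by positivity), lg_one, lg_pow]
  ring

theorem avgRedundancy_nonneg (hp : IsProbVec p) {l : Fin n → ℕ} (hl : l ∈ kraftLengths n) :
    0 ≤ avgRedundancy p l := by
  have := hp.nonempty
  have h := sum_mul_lg_div_le Finset.univ p (fun i => ((2 : ℝ) ^ l i)⁻¹) (fun i _ => hp.pos i)
    (fun i _ => by positivity) Finset.univ_nonempty
  rw [hp.sum_eq_one, one_mul, div_one] at h
  have h0 : (0 : ℝ) < ∑ i, ((2 : ℝ) ^ l i)⁻¹ :=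
    Finset.sum_pos (fun i _ => by positivity) Finset.univ_nonempty
  have h1 := lg_le_lg h0 hl
  rw [lg_one] at h1
  simp only [avgRedundancy, hp.mul_natCast_add_lg, Finset.sum_neg_distrib]
  linarith

theorem expRedundancy_nonneg (hp : IsProbVec p) {l : Fin n → ℕ} (hl : l ∈ kraftLengths n) {d : ℝ}
    (h1 : -1 < d) (h0 : d < 0) : 0 ≤ expRedundancy d p l := by
  refine mul_nonneg_of_nonpos_of_nonpos (one_div_nonpos.2 h0.le) ?_
  rw [← lg_one]
  refine lg_le_lg (hp.expSum_pos d l) ?_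
  have key : ∀ i, p i ^ (1 + d) * (2 : ℝ) ^ (d * (l i : ℝ)) ≤
      (1 + d) * p i + (-d) * ((2 : ℝ) ^ l i)⁻¹ := fun i => by
    -- Weighted AM-GM with weights `1 + d` and `-d`.
    have h := Real.geom_mean_le_arith_mean2_weighted (by linarith : 0 ≤ 1 + d)
      (by linarith : 0 ≤ -d) (hp.pos i).le (by positivity : (0 : ℝ) ≤ ((2 : ℝ) ^ l i)⁻¹) (by ring)
    rwa [← Real.rpow_natCast, ← Real.rpow_neg (by norm_num), ← Real.rpow_mul (by norm_num),
      neg_mul_neg, mul_comm (l i : ℝ) d, Real.rpow_neg (by norm_num), Real.rpow_natCast] at h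
  refine (Finset.sum_le_sum fun i _ => key i).trans ?_
  rw [Finset.sum_add_distrib, ← Finset.mul_sum, ← Finset.mul_sum, hp.sum_eq_one]
  have hl' : ∑ i, ((2 : ℝ) ^ l i)⁻¹ ≤ 1 := hl
  nlinarith

theorem avgOpt_nonneg (hp : IsProbVec p) : 0 ≤ avgOpt p := by
  obtain ⟨l, hl, e⟩ := hp.isLeast_avgOpt.1
  exact e ▸ hp.avgRedundancy_nonneg hl

theorem expOpt_nonneg (hp : IsProbVec p) {d : ℝ} (h1 : -1 < d) (h0 : d < 0) : 0 ≤ expOpt d p := by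
  obtain ⟨l, hl, e⟩ := (hp.isLeast_expOpt d).1
  exact e ▸ hp.expRedundancy_nonneg hl h1 h0

theorem avgOpt_le_expOpt (hp : IsProbVec p) {d : ℝ} (hd : 0 < d) : avgOpt p ≤ expOpt d p :=
  optimum_le_optimum hp.isLeast_avgOpt (hp.isLeast_expOpt d) (hp.avgRedundancy_le_expRedundancy hd)

theorem expOpt_le_avgOpt (hp : IsProbVec p) {d : ℝ} (hd : d < 0) : expOpt d p ≤ avgOpt p :=
  optimum_le_optimum (hp.isLeast_expOpt d) hp.isLeast_avgOpt (hp.expRedundancy_le_avgRedundancy hd)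

theorem avgOpt_le_maxOpt (hp : IsProbVec p) : avgOpt p ≤ maxOpt p :=
  optimum_le_optimum hp.isLeast_avgOpt hp.isLeast_maxOpt hp.avgRedundancy_le_maxRedundancy

theorem expOpt_le_maxOpt (hp : IsProbVec p) {d : ℝ} (hd : d ≠ 0) : expOpt d p ≤ maxOpt p := by
  rcases hd.lt_or_gt with h | h
  · exact (hp.expOpt_le_avgOpt h).trans hp.avgOpt_le_maxOpt
  · exact optimum_le_optimum (hp.isLeast_expOpt d) hp.isLeast_maxOpt
      (hp.expRedundancy_le_maxRedundancy h)

/-! ### Upper bounds in terms of one probability -/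

/-- The letter `j` can be given any length `k` as long as the other letters, with their
probabilities scaled by `c`, fit into the rest of the Kraft sum. -/
theorem exists_kraftLengths_of_scale (hp : IsProbVec p) (j : Fin n) (k : ℕ) {c : ℝ} (hc : 0 < c)
    (h : ((2 : ℝ) ^ k)⁻¹ + (1 - p j) * c ≤ 1) :
    ∃ l ∈ kraftLengths n, l j = k ∧ ∀ i ≠ j, (l i : ℝ) + lg (p i) < lg (2 / c) := by
  obtain ⟨l, hl, hq⟩ := exists_kraftLengths_near
    (fun i => if i = j then ((2 : ℝ) ^ k)⁻¹ else c * p i)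
    (fun i => by
      have := hp.pos i
      split_ifs <;> positivity)
    (by
      rw [← Finset.add_sum_erase _ _ (Finset.mem_univ j), if_pos rfl,
        Finset.sum_congr rfl fun i hi => if_neg (Finset.ne_of_mem_erase hi), ← Finset.mul_sum,
        hp.sum_erase, mul_comm c]
      exact h)
  refine ⟨l, hl, ?_, fun i hi => ?_⟩
  · have hj := hq j
    simp only [if_true] at hj
    -- Rounding fixes `2⁻ᵏ`.
    have h1 : (2 : ℝ) ^ k ≤ 2 ^ l j := (inv_le_inv₀ (by positivity) (by positivity)).1 hj.1
    have h2 : (2 : ℝ) ^ l j < 2 ^ (k + 1) := by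
      have := hj.2
      rw [← div_eq_mul_inv, lt_div_iff₀ (by positivity), inv_mul_lt_iff₀ (by positivity)] at this
      rwa [pow_succ]
    have h1' := (pow_le_pow_iff_right₀ (by norm_num : (1 : ℝ) < 2)).1 h1
    have h2' := (pow_lt_pow_iff_right₀ (by norm_num : (1 : ℝ) < 2)).1 h2
    omega
  · have h2 := (hq i).2
    simp only [if_neg hi] at h2
    rw [natCast_add_lg _ (hp.pos i)]
    refine lg_lt_lg (mul_pos (by positivity) (hp.pos i)) ?_
    rw [← div_eq_mul_inv, lt_div_iff₀ (by positivity)] at h2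
    rw [lt_div_iff₀ hc]
    linarith

theorem maxOpt_lt_of_length (hp : IsProbVec p) (j : Fin n) {k : ℕ} (hk : 1 ≤ k)
    (h : p j < 2 / ((2 : ℝ) ^ k + 1)) :
    maxOpt p < 1 + lg ((1 - p j) / (1 - ((2 : ℝ) ^ k)⁻¹)) := by
  have := hp.nonempty
  have hk2 : (2 : ℝ) ≤ 2 ^ k := by simpa using pow_le_pow_right₀ (one_le_two (α := ℝ)) hk
  have hinv : ((2 : ℝ) ^ k)⁻¹ < 1 := inv_lt_one_of_one_lt₀ (by linarith)
  have hj := hp.pos j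
  rw [lt_div_iff₀ (by linarith)] at h
  have hj1 : p j < 1 := by nlinarith
  have ha : 0 < 1 - p j := by linarith
  have hb : 0 < 1 - ((2 : ℝ) ^ k)⁻¹ := by linarith
  obtain ⟨l, hl, hlj, hli⟩ := hp.exists_kraftLengths_of_scale j k (div_pos hb ha)
    (by rw [mul_div_cancel₀ _ ha.ne']; linarith)
  refine (hp.isLeast_maxOpt.2 ⟨l, hl, rfl⟩).trans_lt (maxRedundancy_lt fun i => ?_)
  have e : 1 + lg ((1 - p j) / (1 - ((2 : ℝ) ^ k)⁻¹)) =
      lg (2 / ((1 - ((2 : ℝ) ^ k)⁻¹) / (1 - p j))) := by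
    rw [div_div_eq_mul_div, mul_div_assoc, lg_mul two_pos (div_pos ha hb), lg_two]
  rw [e]
  rcases eq_or_ne i j with rfl | hi
  · rw [hlj, natCast_add_lg _ hj]
    refine lg_lt_lg (mul_pos (by positivity) hj) ?_
    rw [lt_div_iff₀ (div_pos hb ha), ← mul_div_assoc, div_lt_iff₀ ha]
    have : (2 : ℝ) ^ k * p i * (1 - ((2 : ℝ) ^ k)⁻¹) = p i * (2 ^ k - 1) := by field_simp
    rw [this]
    linarith
  · exact hli i hi

theorem maxOpt_le_of_length (hp : IsProbVec p) (j : Fin n) {k : ℕ}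
    (h : 2 / ((2 : ℝ) ^ k + 1) ≤ p j) : maxOpt p ≤ k + lg (p j) := by
  have := hp.nonempty
  have hj := hp.pos j
  have hk : (0 : ℝ) < 2 ^ k := by positivity
  rw [div_le_iff₀ (by linarith)] at h
  obtain ⟨l, hl, hlj, hli⟩ := hp.exists_kraftLengths_of_scale j k
    (c := 2 / (2 ^ k * p j)) (by positivity) (by
      rw [← sub_nonneg]
      have : 1 - (((2 : ℝ) ^ k)⁻¹ + (1 - p j) * (2 / (2 ^ k * p j))) =
          (p j * (2 ^ k + 1) - 2) / (2 ^ k * p j) := by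
        field_simp
        ring
      rw [this]
      exact div_nonneg (by linarith) (by positivity))
  refine (hp.isLeast_maxOpt.2 ⟨l, hl, rfl⟩).trans (ciSup_le fun i => ?_)
  rcases eq_or_ne i j with rfl | hi
  · rw [hlj]
  · refine (hli i hi).le.trans_eq ?_
    rw [natCast_add_lg _ hj]
    congr 1
    field_simp

/-! ### The lower bound for average redundancy -/

/-- The log-sum inequality over the letters other than `j`. -/
theorem le_avgRedundancy (hp : IsProbVec p) {l : Fin n → ℕ} (hl : l ∈ kraftLengths n) {j : Fin n}
    (hj : p j < 1) :
    1 ≤ l j ∧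
      (l j : ℝ) - (1 - p j) * lg ((2 : ℝ) ^ l j - 1) - binaryEntropy (p j) ≤ avgRedundancy p l := by
  have hpj := hp.pos j
  have hne : (Finset.univ.erase j).Nonempty := by
    rw [Finset.nonempty_iff_ne_empty]
    intro h
    have := hp.sum_erase j
    rw [h, Finset.sum_empty] at this
    linarith
  have hB : 0 < ∑ i ∈ Finset.univ.erase j, ((2 : ℝ) ^ l i)⁻¹ :=
    Finset.sum_pos (fun i _ => by positivity) hne
  have hK : ((2 : ℝ) ^ l j)⁻¹ + ∑ i ∈ Finset.univ.erase j, ((2 : ℝ) ^ l i)⁻¹ ≤ 1 := by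
    rw [Finset.add_sum_erase _ (fun i => ((2 : ℝ) ^ l i)⁻¹) (Finset.mem_univ j)]
    exact hl
  have h1 : 1 ≤ l j := by
    by_contra h
    have : l j = 0 := by omega
    rw [this, pow_zero, inv_one] at hK
    linarith
  refine ⟨h1, ?_⟩
  have hk2 : (2 : ℝ) ≤ 2 ^ l j := by simpa using pow_le_pow_right₀ (one_le_two (α := ℝ)) h1
  have h := sum_mul_lg_div_le (Finset.univ.erase j) p (fun i => ((2 : ℝ) ^ l i)⁻¹)
    (fun i _ => hp.pos i) (fun i _ => by positivity) hne
  rw [hp.sum_erase] at h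
  have ha : 0 < 1 - p j := by linarith
  have hm : lg ((∑ i ∈ Finset.univ.erase j, ((2 : ℝ) ^ l i)⁻¹) / (1 - p j)) ≤
      lg ((2 : ℝ) ^ l j - 1) - l j - lg (1 - p j) := by
    rw [← lg_pow (l j), ← lg_div (by linarith) (by positivity),
      ← lg_div (div_pos (by linarith) (by positivity)) ha]
    refine lg_le_lg (div_pos hB ha) ?_
    gcongr
    rw [sub_div, div_self (by positivity), one_div]
    linarith
  have h' := h.trans (mul_le_mul_of_nonneg_left hm ha.le)
  rw [avgRedundancy, ← Finset.add_sum_erase _ _ (Finset.mem_univ j)]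
  simp only [hp.mul_natCast_add_lg l, Finset.sum_neg_distrib]
  rw [← hp.mul_natCast_add_lg]
  rw [binaryEntropy]
  nlinarith

end IsProbVec

/-- The part of the lower bound on average redundancy that depends on the length `k` of the
codeword whose probability is `x`. -/
noncomputable def lengthCost (x : ℝ) (k : ℕ) : ℝ := k - (1 - x) * lg ((2 : ℝ) ^ k - 1)

/-- The threshold for the increments of `lengthCost`. -/
theorem lengthCost_le_succ_iff {x : ℝ} (h0 : 0 < x) (h1 : x < 1) {k : ℕ} (hk : 1 ≤ k) :
    lengthCost x k ≤ lengthCost x (k + 1) ↔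
      lg ((1 - (2 : ℝ) ^ (1 / (x - 1))) / (1 - (2 : ℝ) ^ (x / (x - 1)))) ≤ k := by
  have hk2 : (2 : ℝ) ≤ 2 ^ k := by simpa using pow_le_pow_right₀ (one_le_two (α := ℝ)) hk
  set b : ℝ := (2 : ℝ) ^ (1 / (x - 1)) with hb
  have hb0 : 0 < b := by positivity
  have e : (2 : ℝ) ^ (x / (x - 1)) = 2 * b := by
    have : x / (x - 1) = 1 + 1 / (x - 1) := by
      have : x - 1 ≠ 0 := by linarith
      field_simp
      ring
    rw [this, Real.rpow_add two_pos, Real.rpow_one]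
  have hb1 : 2 * b < 1 := by
    rw [← e]
    exact Real.rpow_lt_one_of_one_lt_of_neg (by norm_num)
      (div_neg_of_pos_of_neg h0 (by linarith))
  have hlgb : lg b = -(1 / (1 - x)) := by
    rw [hb, lg_rpow, ← neg_sub 1 x, div_neg]
  have hkk : (2 : ℝ) ^ (k + 1) = 2 * 2 ^ k := by ring
  have hx : 0 < 1 - x := by linarith
  have hr : 0 < (1 - b) / (1 - 2 * b) := div_pos (by linarith) (by linarith)
  have hm : (0 : ℝ) < 2 ^ k - 1 := by linarith
  have hm' : (0 : ℝ) < 2 * 2 ^ k - 1 := by linarith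
  rw [e, lengthCost, lengthCost, hkk]
  have a1 : (k - (1 - x) * lg ((2 : ℝ) ^ k - 1) ≤
      ((k + 1 : ℕ) : ℝ) - (1 - x) * lg (2 * 2 ^ k - 1)) ↔
      lg (b * (2 * 2 ^ k - 1)) ≤ lg (2 ^ k - 1) := by
    rw [lg_mul hb0 hm', hlgb, ← mul_le_mul_iff_right₀ hx (b := -(1 / (1 - x)) + _), mul_add,
      mul_neg, mul_one_div_cancel hx.ne']
    push_cast
    constructor <;> intro h <;> linarith
  have a2 : lg (b * (2 * 2 ^ k - 1)) ≤ lg (2 ^ k - 1) ↔ b * (2 * 2 ^ k - 1) ≤ 2 ^ k - 1 :=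
    Real.logb_le_logb (by norm_num) (mul_pos hb0 hm') hm
  have a3 : lg ((1 - b) / (1 - 2 * b)) ≤ k ↔ (1 - b) / (1 - 2 * b) ≤ 2 ^ k := by
    rw [← lg_pow k]
    exact Real.logb_le_logb (by norm_num) hr (by positivity)
  rw [a1, a2, a3, div_le_iff₀ (by linarith)]
  constructor <;> intro h <;> linarith

theorem one_le_xi {x : ℝ} (h0 : 0 < x) (h1 : x < 1) : 1 ≤ xi x := by
  have h2 : x / (x - 1) < 0 := div_neg_of_pos_of_neg h0 (by linarith)
  have h3 : 1 / (x - 1) < x / (x - 1) :=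
    div_lt_div_of_neg_of_lt (by linarith) h1
  have h4 : (2 : ℝ) ^ (x / (x - 1)) < 1 := Real.rpow_lt_one_of_one_lt_of_neg (by norm_num) h2
  have h5 : (2 : ℝ) ^ (1 / (x - 1)) < (2 : ℝ) ^ (x / (x - 1)) :=
    Real.rpow_lt_rpow_of_exponent_lt (by norm_num) h3
  rw [xi, Int.one_le_ceil_iff, ← lg_one]
  exact lg_lt_lg one_pos ((one_lt_div (by linarith)).2 (by linarith))

/-- The integer `xi x` minimizes `lengthCost x` over positive lengths, being the first point at
which the increment is nonnegative. -/
theorem lengthCost_xi_le {x : ℝ} (h0 : 0 < x) (h1 : x < 1) {m k : ℕ} (hm : xi x = m) (hk : 1 ≤ k) :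
    lengthCost x m ≤ lengthCost x k := by
  have hstep : ∀ i : ℕ, 1 ≤ i → (lengthCost x i ≤ lengthCost x (i + 1) ↔ m ≤ i) := fun i hi => by
    rw [lengthCost_le_succ_iff h0 h1 hi]
    have h : xi x ≤ (i : ℤ) ↔ _ := Int.ceil_le
    rw [hm, Int.cast_natCast] at h
    rw [← h, Nat.cast_le]
  rcases le_total m k with h | h
  · induction k, h using Nat.le_induction with
    | base => rfl
    | succ i hi ih =>
      have := one_le_xi h0 h1
      have hi1 : 1 ≤ i := by omega
      exact (ih hi1).trans ((hstep i hi1).2 hi)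
  · induction h using Nat.decreasingInduction with
    | self => rfl
    | of_succ i hi ih =>
      have : ¬ lengthCost x i ≤ lengthCost x (i + 1) := by
        rw [hstep i hk]
        omega
      exact (ih (by omega)).trans (not_le.1 this).le

theorem huffmanLowerBound_eq {x : ℝ} {m : ℕ} (hm : xi x = m) :
    huffmanLowerBound x = lengthCost x m - binaryEntropy x := by
  rw [huffmanLowerBound, hm, lengthCost]
  simp

theorem IsProbVec.huffmanLowerBound_le_avgOpt {n : ℕ} {p : Fin n → ℝ} (hp : IsProbVec p)
    {j : Fin n} (hj : p j < 1) : huffmanLowerBound (p j) ≤ avgOpt p := by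
  obtain ⟨l, hl, e⟩ := hp.isLeast_avgOpt.1
  obtain ⟨m, hm⟩ := Int.eq_ofNat_of_zero_le (zero_le_one.trans (one_le_xi (hp.pos j) hj))
  obtain ⟨h1, h2⟩ := hp.le_avgRedundancy hl hj
  have h3 := lengthCost_xi_le (hp.pos j) hj hm h1
  rw [← e, huffmanLowerBound_eq hm]
  exact (sub_le_sub_right h3 _).trans h2

/-! ### Tightness of the lower bound -/

/-- Equality in the log-sum inequality: one codeword of length `xi x` carries the mass `x`, and the
remaining mass is spread evenly over all words of a common length that complete the code. -/
theorem exists_avgOpt_eq_huffmanLowerBound {x : ℝ} (h0 : 0 < x) (h1 : x < 1) :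
    ∃ (n : ℕ) (p : Fin n → ℝ) (j : Fin n),
      IsProbVec p ∧ p j = x ∧ (∀ i, p i ≤ x) ∧ avgOpt p = huffmanLowerBound x := by
  obtain ⟨m, hm⟩ := Int.eq_ofNat_of_zero_le (zero_le_one.trans (one_le_xi h0 h1))
  have hm1 : 1 ≤ m := by
    have := one_le_xi h0 h1
    omega
  have hm2 : (2 : ℝ) ≤ 2 ^ m := by simpa using pow_le_pow_right₀ (one_le_two (α := ℝ)) hm1
  obtain ⟨k, hk⟩ := pow_unbounded_of_one_lt (1 / x) (one_lt_two (α := ℝ))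
  have hk0 : (0 : ℝ) < 2 ^ k := by positivity
  set N : ℕ := (2 ^ m - 1) * 2 ^ k with hN
  have hNr : (N : ℝ) = (2 ^ m - 1) * 2 ^ k := by
    rw [hN]
    push_cast [Nat.one_le_two_pow]
    ring
  have hN0 : (0 : ℝ) < N := by
    rw [hNr]
    exact mul_pos (by linarith) hk0
  set c : ℝ := (1 - x) / N with hc
  have hc0 : 0 < c := div_pos (by linarith) hN0
  have hcx : c ≤ x := by
    rw [hc, div_le_iff₀ hN0, hNr]
    rw [div_lt_iff₀ h0] at hk
    nlinarith [mul_nonneg (by linarith : (0 : ℝ) ≤ 2 ^ m - 2) (mul_pos hk0 h0).le]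
  have hNc : (N : ℝ) * c = 1 - x := mul_div_cancel₀ _ hN0.ne'
  let p : Fin (N + 1) → ℝ := Fin.cons x fun _ => c
  let l : Fin (N + 1) → ℕ := Fin.cons m fun _ => m + k
  have hp : IsProbVec p :=
    ⟨fun i => by refine Fin.cases ?_ (fun i => ?_) i <;> simpa [p],
      by simp [p, Fin.sum_univ_succ, hNc]⟩
  have hl : l ∈ kraftLengths (N + 1) := by
    have : ((2 : ℝ) ^ m)⁻¹ + N * ((2 : ℝ) ^ (m + k))⁻¹ = 1 := by
      rw [hNr, pow_add]
      field_simp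
      ring
    simpa [kraftLengths, l, Fin.sum_univ_succ] using this.le
  refine ⟨N + 1, p, 0, hp, rfl, fun i => ?_, le_antisymm ?_ ?_⟩
  · refine Fin.cases ?_ (fun i => ?_) i <;> simp [p, hcx]
  · refine (hp.isLeast_avgOpt.2 ⟨l, hl, rfl⟩).trans_eq ?_
    rw [huffmanLowerBound_eq hm, lengthCost, binaryEntropy]
    have hlg : lg c = lg (1 - x) - lg ((2 : ℝ) ^ m - 1) - k := by
      rw [hc, lg_div (by linarith) hN0, hNr, lg_mul (by linarith) hk0, lg_pow]
      ring
    have : avgRedundancy p l = x * (m + lg x) + N * (c * ((m + k : ℕ) + lg c)) := by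
      simp [avgRedundancy, Fin.sum_univ_succ, p, l]
    rw [this, ← mul_assoc, hNc, hlg]
    push_cast
    ring
  · exact hp.huffmanLowerBound_le_avgOpt (j := 0) h1

theorem corollary1 :
    (∀ (n : ℕ) (p : Fin n → ℝ), IsProbVec p →
      -- the optimal values are attained minima
      IsLeast (avgRedundancy p '' kraftLengths n) (avgOpt p) ∧
      IsLeast (maxRedundancy p '' kraftLengths n) (maxOpt p) ∧
      (∀ d : ℝ, d ≠ 0 → IsLeast (expRedundancy d p '' kraftLengths n) (expOpt d p)) ∧
      -- comparison of the optimal values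
      (∀ d : ℝ, 0 < d →
        0 ≤ avgOpt p ∧ avgOpt p ≤ expOpt d p ∧ expOpt d p ≤ maxOpt p ∧ maxOpt p < 1) ∧
      (∀ d : ℝ, -1 < d → d < 0 → 0 ≤ expOpt d p) ∧
      (∀ d : ℝ, d < 0 →
        expOpt d p ≤ avgOpt p ∧ avgOpt p ≤ maxOpt p ∧ maxOpt p < 1) ∧
      -- upper bounds in terms of one probability, for every `d`
      (∀ d : ℝ, d ≠ 0 → ∀ j : Fin n,
        (2 / 3 ≤ p j → expOpt d p ≤ 1 + lg (p j)) ∧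
        (1 / 2 ≤ p j → p j < 2 / 3 → expOpt d p < 2 + lg (1 - p j)) ∧
        (p j < 1 / 2 → ∀ lam : ℤ, lam = ⌈-lg (p j)⌉ →
          (p j < 2 / ((2 : ℝ) ^ lam + 1) →
            expOpt d p < 1 + lg ((1 - p j) / (1 - (2 : ℝ) ^ (-lam)))) ∧
          (2 / ((2 : ℝ) ^ lam + 1) ≤ p j → expOpt d p ≤ (lam : ℝ) + lg (p j)))) ∧
      -- for `d < 0`, any upper bound for average redundancy in terms of one probability,
      -- or in terms of the largest probability, is an upper bound
      (∀ d : ℝ, d < 0 → ∀ (ω : ℝ → ℝ) (j : Fin n),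
        ((∀ (m : ℕ) (q : Fin m → ℝ), IsProbVec q → ∀ i, avgOpt q ≤ ω (q i)) →
          expOpt d p ≤ ω (p j)) ∧
        ((∀ (m : ℕ) (q : Fin m → ℝ), IsProbVec q → ∀ i, (∀ k, q k ≤ q i) →
            avgOpt q ≤ ω (q i)) →
          (∀ k, p k ≤ p j) → expOpt d p ≤ ω (p j))) ∧
      -- the lower bound for average redundancy, and for `d > 0`
      (∀ j : Fin n, p j < 1 →
        huffmanLowerBound (p j) ≤ avgOpt p ∧
        ∀ d : ℝ, 0 < d → huffmanLowerBound (p j) ≤ expOpt d p)) ∧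
    -- the lower bound for average redundancy is tight, even for the largest probability
    (∀ x : ℝ, 0 < x → x < 1 →
      ∃ (n : ℕ) (p : Fin n → ℝ) (j : Fin n),
        IsProbVec p ∧ p j = x ∧ (∀ i, p i ≤ x) ∧ avgOpt p = huffmanLowerBound x) := by
  refine ⟨fun n p hp => ⟨hp.isLeast_avgOpt, hp.isLeast_maxOpt, fun d _ => hp.isLeast_expOpt d,
    fun d hd => ⟨hp.avgOpt_nonneg, hp.avgOpt_le_expOpt hd, hp.expOpt_le_maxOpt hd.ne',
      hp.maxOpt_lt_one⟩,
    fun d h1 h0 => hp.expOpt_nonneg h1 h0,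
    fun d hd => ⟨hp.expOpt_le_avgOpt hd, hp.avgOpt_le_maxOpt, hp.maxOpt_lt_one⟩,
    fun d hd j => ⟨fun h => ?_, fun _ h => ?_, fun hj lam hlam => ?_⟩,
    fun d hd ω j => ⟨fun h => (hp.expOpt_le_avgOpt hd).trans (h n p hp j),
      fun h hmax => (hp.expOpt_le_avgOpt hd).trans (h n p hp j hmax)⟩,
    fun j hj => ⟨hp.huffmanLowerBound_le_avgOpt hj,
      fun d hd => (hp.huffmanLowerBound_le_avgOpt hj).trans (hp.avgOpt_le_expOpt hd)⟩⟩,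
    fun x h0 h1 => exists_avgOpt_eq_huffmanLowerBound h0 h1⟩
  · have := hp.maxOpt_le_of_length j (k := 1) (by norm_num; exact h)
    exact (hp.expOpt_le_maxOpt hd).trans (by simpa using this)
  · have h2 := hp.maxOpt_lt_of_length j (k := 1) le_rfl (by norm_num; exact h)
    refine (hp.expOpt_le_maxOpt hd).trans_lt (h2.trans_eq ?_)
    have e : (1 - p j) / (1 - ((2 : ℝ) ^ 1)⁻¹) = 2 * (1 - p j) := by
      norm_num
      ring
    rw [e, lg_mul two_pos (by linarith), lg_two]
    ring
  · have h1 : 1 ≤ lam := by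
      rw [hlam, Int.one_le_ceil_iff, neg_pos, ← lg_one]
      exact lg_lt_lg (hp.pos j) (by linarith)
    obtain ⟨k, rfl⟩ := Int.eq_ofNat_of_zero_le (zero_le_one.trans h1)
    simp only [zpow_neg, zpow_natCast, Int.cast_natCast]
    exact ⟨fun h => (hp.expOpt_le_maxOpt hd).trans_lt
        (hp.maxOpt_lt_of_length j (by exact_mod_cast h1) h),
      fun h => (hp.expOpt_le_maxOpt hd).trans (hp.maxOpt_le_of_length j h)⟩
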